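/- Let $f_0:[0,1]\to\mathbb R$ satisfy $f_0(r)=\tilde f_0(r^2)$ with $\tilde f_0\in C^{2,\beta}([0,1])$ for some $\beta\in(0,1)$, and $\inf_{r\in(0,1]}f_0'(r)/r>0$. Put $$\kappa_1=\inf_{r\in[0,1]}\int_0^1 sf_0(rs)\,ds,\qquad \kappa_2=\sup_{r\in[0,1]}\int_0^1 sf_0(rs)\,ds,\qquad \mu^0_\Omega(r)=\frac{f_0'(r)}{r\big(\Omega-\int_0^1 sf_0(rs)\,ds\big)},$$ $$\widehat\Omega_n=\int_0^1 sf_0(s)\,ds-\frac{n+1}{n}\int_0^1 s^{2n+1}f_0(s)\,ds,\qquad H_n[h](r)=r^{2n}\int_r^1 s^{1-n}h(s)\,ds+\int_0^r s^{n+1}h(s)\,ds,$$ $$G_n(r)=n\Omega r^{n+1}+r^{n-1}\int_0^1 sf_0(s)\,ds-(n+1)r^{n-1}\int_0^r sf_0(s)\,ds+\frac{n+1}{r^{n+1}}\int_0^r s^{2n+1}f_0(s)\,ds,$$ so that $G_n(1)=n(\Omega-\widehat\Omega_n)$. For every integer $n\ge1$ and every real $\Omega\notin[\kappa_1,\kappa_2]$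 there is a unique function $F_{n,\Omega}$ of class $C^2$ on $[0,1]$ such that $$F_{n,\Omega}''+\frac{2n+1}{r}F_{n,\Omega}'+\mu^0_\Omega F_{n,\Omega}=0\ \text{ on }(0,1],\qquad F_{n,\Omega}(0)=1;$$ set $$\zeta_n(\Omega)=F_{n,\Omega}(1)\Big(\Omega-\frac{n}{n+1}\int_0^1 sf_0(s)\,ds\Big)+\int_0^1F_{n,\Omega}(s)\,s^{2n+1}\big(f_0(s)-2\Omega\big)\,ds.$$ There is a constant $C_0>0$ depending only on $f_0$ such that the following holds for every integer $n\ge1$ and every real $\Omega\notin[\kappa_1,\kappa_2]$ with $\Omega\ne\widehat\Omega_n$. If $\Omega>\kappa_2$, assume moreover that $$\frac{C_0}{n\,\theta\,(\Omega-\kappa_2)^\theta}<1\quad\text{for some }\theta\in(0,1].$$ Then the equation $$h(r)-\frac{\mu^0_\Omega(r)}{2nr^n}H_n[h](r)=-\frac{H_n[h](1)}{2nG_n(1)}\,\mu^0_\Omega(r)\,r\,G_n(r),\qquad r\in(0,1],$$ has a solution $h$ that is continuous on $[0,1]$ and not identically zero if and only if $\zeta_n(\Omega)=0$. -/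

import Mathlib

open Set MeasureTheory
open scoped NNReal

noncomputable section

/-- The admissible profiles `f₀ : [0,1] → ℝ` (values outside `[0,1]` are irrelevant):
`f₀ r = g (r²)` with `g` of class `C^{2,β}` on `[0,1]` for some `β ∈ (0,1)`, and
`inf_{0 < r ≤ 1} f₀'(r) / r > 0`. Derivatives on `[0,1]` are one-sided at the end points. -/
structure IsProfile (f₀ : ℝ → ℝ) : Prop where
  regular : ∃ (g : ℝ → ℝ) (β C : ℝ≥0), 0 < β ∧ β < 1 ∧
    ContDiffOn ℝ 2 g (Icc 0 1) ∧
    HolderOnWith C β (iteratedDerivWithin 2 g (Icc 0 1)) (Icc 0 1) ∧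
    ∀ r ∈ Icc (0 : ℝ) 1, f₀ r = g (r ^ 2)
  monotone : ∃ c : ℝ, 0 < c ∧ ∀ r ∈ Ioc (0 : ℝ) 1, c ≤ derivWithin f₀ (Icc 0 1) r / r

/-- The average `∫₀¹ s f₀(r s) ds`. -/
def profileMean (f₀ : ℝ → ℝ) (r : ℝ) : ℝ := ∫ s in (0 : ℝ)..1, s * f₀ (r * s)

/-- `κ₁ = inf_{r ∈ [0,1]} ∫₀¹ s f₀(r s) ds`. -/
def kappa₁ (f₀ : ℝ → ℝ) : ℝ := sInf (profileMean f₀ '' Icc 0 1)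

/-- `κ₂ = sup_{r ∈ [0,1]} ∫₀¹ s f₀(r s) ds`. -/
def kappa₂ (f₀ : ℝ → ℝ) : ℝ := sSup (profileMean f₀ '' Icc 0 1)

/-- The potential `μ_Ω⁰(r) = f₀'(r) / (r (Ω - ∫₀¹ s f₀(r s) ds))`, for `r ∈ (0,1]`. -/
def mu (f₀ : ℝ → ℝ) (Ω r : ℝ) : ℝ :=
  derivWithin f₀ (Icc 0 1) r / (r * (Ω - profileMean f₀ r))

/-- The singular value `Ω̂_n`. -/
def omegaHat (f₀ : ℝ → ℝ) (n : ℕ) : ℝ :=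
  (∫ s in (0 : ℝ)..1, s * f₀ s)
    - ((n : ℝ) + 1) / n * ∫ s in (0 : ℝ)..1, s ^ (2 * n + 1) * f₀ s

/-- `H_n[h](r) = r^{2n} ∫_r^1 s^{1-n} h(s) ds + ∫_0^r s^{n+1} h(s) ds`. -/
def Hop (n : ℕ) (h : ℝ → ℝ) (r : ℝ) : ℝ :=
  r ^ (2 * n) * (∫ s in r..1, s ^ (1 - (n : ℤ)) * h s)
    + ∫ s in (0 : ℝ)..r, s ^ (n + 1) * h s

/-- The function `G_n`, for `n ≥ 1` and `r ∈ (0,1]`. -/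
def Gfun (f₀ : ℝ → ℝ) (Ω : ℝ) (n : ℕ) (r : ℝ) : ℝ :=
  n * Ω * r ^ (n + 1)
    + r ^ (n - 1) * (∫ s in (0 : ℝ)..1, s * f₀ s)
    - ((n : ℝ) + 1) * r ^ (n - 1) * (∫ s in (0 : ℝ)..r, s * f₀ s)
    + ((n : ℝ) + 1) / r ^ (n + 1) * ∫ s in (0 : ℝ)..r, s ^ (2 * n + 1) * f₀ s

/-- `h` solves the kernel equation of mode `n` (with `n ≥ 1` and `G_n(1) ≠ 0`) on `(0,1]`. -/
def SolvesKernelEq (f₀ : ℝ → ℝ) (Ω : ℝ) (n : ℕ) (h : ℝ → ℝ) : Prop :=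
  ∀ r ∈ Ioc (0 : ℝ) 1,
    h r - mu f₀ Ω r / (2 * n * r ^ n) * Hop n h r
      = -(Hop n h 1 / (2 * n * Gfun f₀ Ω n 1)) * mu f₀ Ω r * r * Gfun f₀ Ω n r

/-- `F` is of class `C²` on `[0,1]`, `F(0) = 1` and `F'' + (2n+1)/r F' + μ_Ω⁰ F = 0`. -/
structure IsRegularSolution (f₀ : ℝ → ℝ) (n : ℕ) (Ω : ℝ) (F : ℝ → ℝ) : Prop where
  contDiffOn : ContDiffOn ℝ 2 F (Icc 0 1)
  init : F 0 = 1
  ode : ∀ r ∈ Ioc (0 : ℝ) 1,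
    derivWithin (derivWithin F (Icc 0 1)) (Icc 0 1) r
      + (2 * n + 1) / r * derivWithin F (Icc 0 1) r + mu f₀ Ω r * F r = 0

/-- The solution `F_{n,Ω}`. That it exists and is unique on `[0,1]` is part of the theorem. -/
def generator (f₀ : ℝ → ℝ) (n : ℕ) (Ω : ℝ) : ℝ → ℝ :=
  Classical.epsilon (IsRegularSolution f₀ n Ω)

/-- The dispersion function `ζ_n(Ω)`. -/
def zeta (f₀ : ℝ → ℝ) (n : ℕ) (Ω : ℝ) : ℝ :=
  generator f₀ n Ω 1 * (Ω - (n : ℝ) / (n + 1) * ∫ s in (0 : ℝ)..1, s * f₀ s)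
    + ∫ s in (0 : ℝ)..1, generator f₀ n Ω s * s ^ (2 * n + 1) * (f₀ s - 2 * Ω)

end

/-! The kernel equation is an ODE in disguise. With `c = H_n[h](1)/G_n(1)` and the amplitude `y =
r^{-2n}(H_n[h] - c r^{n+1} G_n)`, it reads `h = μ r^n y/(2n)`. Differentiating twice gives
`(r^{2n+1} y')' = r^{2n+1}(2n(n+1)c(f₀ - 2Ω) - μ y)`, with `y(1) = 0` and `y'(1) = -2n(n+1)c(Ω -
n/(n+1)∫₀¹ s f₀)`. Pairing with the regular homogeneous solution `F`
(`IsRadialPair.integral_eq_wronskian`) yields `2n(n+1) c ζ_n = 0`. If `ζ_n ≠ 0`, then `c = 0`, so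
`y` is homogeneous with zero Cauchy data at 1 and `h` vanishes (`eq_zero_of_kernelEq`). If `ζ_n =
0`, the same identity is the compatibility condition that lets a multiple of `F` correct a
particular solution to both data at 1 with `c = 1` (`exists_isRadialPair_of_dispersion`).
Integrating the ODE back recovers the kernel equation (`Hop_of_isRadialPair`). The function `F`
comes from Picard iteration for an integral equation that is not singular at 0. -/

open Filter Topology

/-! ### Radial means and the regular inverse of the radial operator -/

/-- The weighted mean `∫₀¹ s^N ψ(r s) ds`. -/
noncomputable def radialMean (N : ℕ) (ψ : ℝ → ℝ) (r : ℝ) : ℝ := ∫ s in (0 : ℝ)..1, s ^ N * ψ (r * s)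

/-- The solution `y` of `(r^N y')' = r^N ψ` with `y(0) = y'(0) = 0`. -/
noncomputable def radialInt (N : ℕ) (ψ : ℝ → ℝ) (r : ℝ) : ℝ := ∫ t in (0 : ℝ)..r, t * radialMean N ψ t

theorem continuous_radialMean (N : ℕ) {ψ : ℝ → ℝ} (hψ : Continuous ψ) :
    Continuous (radialMean N ψ) := by
  unfold radialMean
  apply intervalIntegral.continuous_parametric_intervalIntegral_of_continuous'
  fun_prop

/-- Substitute `t = r s`. The mean is thus `r^{-(N+1)} ∫₀^r t^N ψ`, in a form that stays continuous
at 0. -/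
theorem pow_mul_radialMean (N : ℕ) (ψ : ℝ → ℝ) (r : ℝ) :
    r ^ (N + 1) * radialMean N ψ r = ∫ t in (0 : ℝ)..r, t ^ N * ψ t := by
  have h := intervalIntegral.mul_integral_comp_mul_left (a := 0) (b := 1)
    (f := fun t => t ^ N * ψ t) (c := r)
  simp only [mul_zero, mul_one] at h
  rw [← h, radialMean, pow_succ', mul_assoc, ← intervalIntegral.integral_const_mul]
  congr 2
  ext s
  ring

theorem hasDerivAt_radialInt (N : ℕ) {ψ : ℝ → ℝ} (hψ : Continuous ψ) (r : ℝ) :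
    HasDerivAt (radialInt N ψ) (r * radialMean N ψ r) r := by
  have hc : Continuous fun t => t * radialMean N ψ t :=
    continuous_id.mul (continuous_radialMean N hψ)
  exact intervalIntegral.integral_hasDerivAt_right (hc.intervalIntegrable _ _)
    hc.aestronglyMeasurable.stronglyMeasurableAtFilter hc.continuousAt

theorem hasDerivAt_integral_pow_mul (N : ℕ) {ψ : ℝ → ℝ} (hψ : Continuous ψ) (r : ℝ) :
    HasDerivAt (fun r => ∫ t in (0 : ℝ)..r, t ^ N * ψ t) (r ^ N * ψ r) r := by
  have hc : Continuous fun t => t ^ N * ψ t := by fun_prop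
  exact intervalIntegral.integral_hasDerivAt_right (hc.intervalIntegrable _ _)
    hc.aestronglyMeasurable.stronglyMeasurableAtFilter hc.continuousAt

theorem radialMean_zero (N : ℕ) (ψ : ℝ → ℝ) : radialMean N ψ 0 = ψ 0 / (N + 1) := by
  simp [radialMean, div_eq_inv_mul]

/-- This is `y'' = ψ - N y'/r`, without a singular quotient. Away from 0 it is the quotient rule; at
0 the slope is the mean itself, with limit `ψ(0)/(N+1)`. -/
theorem hasDerivAt_mul_radialMean (N : ℕ) {ψ : ℝ → ℝ} (hψ : Continuous ψ) (r : ℝ) :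
    HasDerivAt (fun r => r * radialMean N ψ r) (ψ r - N * radialMean N ψ r) r := by
  rcases eq_or_ne r 0 with rfl | hr
  · have hval : ψ 0 - N * radialMean N ψ 0 = radialMean N ψ 0 := by
      rw [radialMean_zero]
      field_simp
      ring
    rw [hval, hasDerivAt_iff_tendsto_slope]
    refine ((continuous_radialMean N hψ).tendsto 0).mono_left nhdsWithin_le_nhds |>.congr' ?_
    filter_upwards [self_mem_nhdsWithin] with t ht
    have ht : t ≠ 0 := ht
    simp [slope_def_field, ht]
  · have h1 := (hasDerivAt_integral_pow_mul N hψ r).div (hasDerivAt_pow N r) (pow_ne_zero N hr)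
    have h2 : HasDerivAt (fun r => r * radialMean N ψ r) _ r := h1.congr_of_eventuallyEq (by
      filter_upwards [isOpen_ne.mem_nhds hr] with t ht
      have ht : t ≠ 0 := ht
      simp only [Pi.div_apply]
      rw [← pow_mul_radialMean]
      field_simp
      ring)
    convert h2 using 1
    rw [← pow_mul_radialMean]
    rcases N with _ | N
    · simp
    · simp only [Nat.add_sub_cancel]
      field_simp
      ring

theorem abs_radialMean_sub_le (N : ℕ) {ψ χ : ℝ → ℝ} (hψ : Continuous ψ) (hχ : Continuous χ)
    {C : ℝ} (hC : 0 ≤ C) {k : ℕ} (h : ∀ t ∈ Icc (0 : ℝ) 1, |ψ t - χ t| ≤ C * t ^ k)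
    {r : ℝ} (hr : r ∈ Icc (0 : ℝ) 1) :
    |radialMean N ψ r - radialMean N χ r| ≤ C * r ^ k := by
  have hr0 := hr.1
  have hr1 := hr.2
  unfold radialMean
  rw [← Real.norm_eq_abs, ← intervalIntegral.integral_sub (Continuous.intervalIntegrable (by fun_prop) _ _)
    (Continuous.intervalIntegrable (by fun_prop) _ _)]
  refine (intervalIntegral.norm_integral_le_of_norm_le_const (C := C * r ^ k) ?_).trans_eq (by simp)
  intro s hs
  rw [uIoc_of_le zero_le_one] at hs
  have hs0 := hs.1.le
  have hs1 := hs.2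
  rw [← mul_sub, Real.norm_eq_abs, abs_mul, abs_of_nonneg (pow_nonneg hs0 N)]
  calc s ^ N * |ψ (r * s) - χ (r * s)| ≤ 1 * |ψ (r * s) - χ (r * s)| := by
        gcongr
        exact pow_le_one₀ hs0 hs1
    _ ≤ C * (r * s) ^ k := by
        rw [one_mul]
        exact h _ ⟨by positivity, mul_le_one₀ hr1 hs0 hs1⟩
    _ ≤ C * r ^ k := by
        gcongr
        exact mul_le_of_le_one_right hr0 hs1

theorem abs_radialInt_sub_le (N : ℕ) {ψ χ : ℝ → ℝ} (hψ : Continuous ψ) (hχ : Continuous χ)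
    {C : ℝ} (hC : 0 ≤ C) {k : ℕ} (h : ∀ t ∈ Icc (0 : ℝ) 1, |ψ t - χ t| ≤ C * t ^ k)
    {r : ℝ} (hr : r ∈ Icc (0 : ℝ) 1) :
    |radialInt N ψ r - radialInt N χ r| ≤ C * (r ^ (k + 1) / (k + 1)) := by
  have h1 := continuous_radialMean N hψ
  have h2 := continuous_radialMean N hχ
  unfold radialInt
  rw [← Real.norm_eq_abs, ← intervalIntegral.integral_sub (Continuous.intervalIntegrable (by fun_prop) _ _)
    (Continuous.intervalIntegrable (by fun_prop) _ _)]
  refine (intervalIntegral.norm_integral_le_of_norm_le (g := fun t => C * t ^ k) hr.1 ?_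
    (Continuous.intervalIntegrable (by fun_prop) _ _)).trans_eq (by simp)
  refine Eventually.of_forall fun t ht => ?_
  have ht' : t ∈ Icc (0 : ℝ) 1 := ⟨ht.1.le, ht.2.trans hr.2⟩
  rw [← mul_sub, Real.norm_eq_abs, abs_mul, abs_of_nonneg ht.1.le]
  calc t * |radialMean N ψ t - radialMean N χ t| ≤ 1 * (C * t ^ k) := by
        gcongr
        · exact ht'.2
        · exact abs_radialMean_sub_le N hψ hχ hC h ht'
    _ = C * t ^ k := one_mul _

theorem continuous_radialInt (N : ℕ) {ψ : ℝ → ℝ} (hψ : Continuous ψ) :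
    Continuous (radialInt N ψ) :=
  continuous_iff_continuousAt.2 fun r => (hasDerivAt_radialInt N hψ r).continuousAt

/-! ### Picard iteration for the singular equation -/

theorem exists_continuous_eqOn_Icc {f : ℝ → ℝ} (hf : ContinuousOn f (Icc 0 1)) :
    ∃ g : ℝ → ℝ, Continuous g ∧ EqOn g f (Icc 0 1) :=
  ⟨IccExtend (zero_le_one' ℝ) (domRestrict (Icc 0 1) f), hf.domRestrict.Icc_extend',
    fun x hx => by rw [IccExtend_of_mem _ _ hx, domRestrict_apply]⟩

/-- One step of the Picard iteration for `(r^N y')' = r^N (φ - μ y)` gains a factor `L r / (k + 1)`. -/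
theorem abs_picard_sub_le (N : ℕ) {φ μ y₁ y₂ ψ₁ ψ₂ : ℝ → ℝ} (h₁ : Continuous ψ₁)
    (h₂ : Continuous ψ₂) (e₁ : ∀ t ∈ Icc (0 : ℝ) 1, ψ₁ t = φ t - μ t * y₁ t)
    (e₂ : ∀ t ∈ Icc (0 : ℝ) 1, ψ₂ t = φ t - μ t * y₂ t) {L C : ℝ} (hC : 0 ≤ C)
    (hL : ∀ t ∈ Icc (0 : ℝ) 1, |μ t| ≤ L) {k : ℕ}
    (h : ∀ t ∈ Icc (0 : ℝ) 1, |y₁ t - y₂ t| ≤ (L * t) ^ k / k.factorial * C)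
    {r : ℝ} (hr : r ∈ Icc (0 : ℝ) 1) :
    |radialInt N ψ₁ r - radialInt N ψ₂ r| ≤ (L * r) ^ (k + 1) / (k + 1).factorial * C := by
  have hL0 : 0 ≤ L := (abs_nonneg _).trans (hL 0 ⟨le_rfl, zero_le_one⟩)
  refine (abs_radialInt_sub_le N h₁ h₂ (C := L ^ (k + 1) / k.factorial * C) (k := k)
    (by positivity) (fun t ht => ?_) hr).trans_eq ?_
  · rw [e₁ t ht, e₂ t ht, show φ t - μ t * y₁ t - (φ t - μ t * y₂ t) = -(μ t * (y₁ t - y₂ t)) by ring,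
      abs_neg, abs_mul]
    calc |μ t| * |y₁ t - y₂ t| ≤ L * ((L * t) ^ k / k.factorial * C) :=
          mul_le_mul (hL t ht) (h t ht) (abs_nonneg _) hL0
      _ = _ := by rw [mul_pow]; ring
  · rw [Nat.factorial_succ, mul_pow]
    push_cast
    field_simp

theorem exists_abs_le_of_continuous {f : ℝ → ℝ} (hf : Continuous f) :
    ∃ L, ∀ t ∈ Icc (0 : ℝ) 1, |f t| ≤ L :=
  isCompact_Icc.exists_bound_of_continuousOn hf.continuousOn

/-- Iterating the Picard estimate bounds the difference by `C (L t)^k/k!` for every `k`, which tends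
to 0. -/
theorem eqOn_of_eq_radialInt (N : ℕ) {φ μ y₁ y₂ ψ₁ ψ₂ : ℝ → ℝ} {a : ℝ} (hμ : Continuous μ)
    (h₁ : Continuous ψ₁) (h₂ : Continuous ψ₂)
    (e₁ : ∀ t ∈ Icc (0 : ℝ) 1, ψ₁ t = φ t - μ t * y₁ t)
    (e₂ : ∀ t ∈ Icc (0 : ℝ) 1, ψ₂ t = φ t - μ t * y₂ t)
    (i₁ : ∀ t ∈ Icc (0 : ℝ) 1, y₁ t = a + radialInt N ψ₁ t)
    (i₂ : ∀ t ∈ Icc (0 : ℝ) 1, y₂ t = a + radialInt N ψ₂ t) : EqOn y₁ y₂ (Icc 0 1) := by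
  obtain ⟨L, hL⟩ := exists_abs_le_of_continuous hμ
  obtain ⟨C, hC⟩ := exists_abs_le_of_continuous
    ((continuous_radialInt N h₁).sub (continuous_radialInt N h₂))
  have hd : ∀ t ∈ Icc (0 : ℝ) 1, y₁ t - y₂ t = radialInt N ψ₁ t - radialInt N ψ₂ t :=
    fun t ht => by rw [i₁ t ht, i₂ t ht]; ring
  have hC0 : 0 ≤ C := (abs_nonneg _).trans (hC 0 ⟨le_rfl, zero_le_one⟩)
  have key : ∀ k : ℕ, ∀ t ∈ Icc (0 : ℝ) 1, |y₁ t - y₂ t| ≤ (L * t) ^ k / k.factorial * C := by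
    intro k
    induction k with
    | zero => intro t ht; rw [hd t ht]; simpa using hC t ht
    | succ k ih =>
      intro t ht
      rw [hd t ht]
      exact abs_picard_sub_le N h₁ h₂ e₁ e₂ hC0 hL ih ht
  intro t ht
  have hlim := (FloorSemiring.tendsto_pow_div_factorial_atTop (L * t)).mul_const C
  rw [zero_mul] at hlim
  have := ge_of_tendsto' hlim fun k => key k t ht
  exact sub_eq_zero.1 (abs_nonpos_iff.1 this)

/-- Some iterate of the Picard map contracts `C([0,1])`, and its fixed point is already fixed by the
map. -/
theorem exists_eq_radialInt (N : ℕ) {φ μ : ℝ → ℝ} (hφ : Continuous φ) (hμ : Continuous μ) (a : ℝ) :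
    ∃ y ψ : ℝ → ℝ, Continuous ψ ∧ (∀ t ∈ Icc (0 : ℝ) 1, ψ t = φ t - μ t * y t) ∧
      ∀ t, y t = a + radialInt N ψ t := by
  obtain ⟨L, hL⟩ := exists_abs_le_of_continuous hμ
  let src : C(Icc (0 : ℝ) 1, ℝ) → ℝ → ℝ := fun u t => φ t - μ t * IccExtend (zero_le_one' ℝ) u t
  have hsrc : ∀ u, Continuous (src u) := fun u => hφ.sub (hμ.mul u.continuous.Icc_extend')
  let T : C(Icc (0 : ℝ) 1, ℝ) → C(Icc (0 : ℝ) 1, ℝ) := fun u =>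
    ⟨fun r => a + radialInt N (src u) r,
      continuous_const.add ((continuous_radialInt N (hsrc u)).comp continuous_subtype_val)⟩
  have key : ∀ (k : ℕ) (u v : C(Icc (0 : ℝ) 1, ℝ)) (t : Icc (0 : ℝ) 1),
      |T^[k] u t - T^[k] v t| ≤ (L * t) ^ k / k.factorial * dist u v := by
    intro k u v
    induction k with
    | zero => intro t; simpa [Real.dist_eq] using ContinuousMap.dist_apply_le_dist (f := u) (g := v) t
    | succ k ih =>
      intro t
      rw [Function.iterate_succ_apply', Function.iterate_succ_apply']
      have := abs_picard_sub_le N (hsrc (T^[k] u)) (hsrc (T^[k] v)) (fun _ _ => rfl)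
        (fun _ _ => rfl) (dist_nonneg (x := u) (y := v)) hL (k := k)
        (fun t ht => by
          rw [IccExtend_of_mem _ _ ht, IccExtend_of_mem _ _ ht]
          exact ih ⟨t, ht⟩) t.2
      simpa [T] using this
  have hL0 : 0 ≤ L := (abs_nonneg _).trans (hL 0 ⟨le_rfl, zero_le_one⟩)
  obtain ⟨k, hk⟩ := ((FloorSemiring.tendsto_pow_div_factorial_atTop L).eventually
    (gt_mem_nhds one_pos)).exists
  have hcon : ContractingWith (L ^ k / k.factorial).toNNReal T^[k] := by
    refine ⟨by simpa using hk, LipschitzWith.of_dist_le_mul fun u v => ?_⟩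
    rw [Real.coe_toNNReal _ (by positivity), ContinuousMap.dist_le (by positivity)]
    intro t
    refine (key k u v t).trans ?_
    have := t.2.1
    gcongr
    exact mul_le_of_le_one_right hL0 t.2.2
  have hfix := hcon.isFixedPt_fixedPoint_iterate
  set u := hcon.fixedPoint T^[k]
  refine ⟨fun t => a + radialInt N (src u) t, src u, hsrc u, fun t ht => ?_, fun _ => rfl⟩
  have h := DFunLike.congr_fun hfix ⟨t, ht⟩
  simp only [src, IccExtend_of_mem _ _ ht]
  rw [← h]
  rfl

/-! ### Existence and uniqueness of the regular solution -/

theorem IsProfile.continuousOn {f₀ : ℝ → ℝ} (hf₀ : IsProfile f₀) : ContinuousOn f₀ (Icc 0 1) := by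
  obtain ⟨g, β, C, -, -, hg, -, hfg⟩ := hf₀.regular
  refine ContinuousOn.congr (f := fun r => g (r ^ 2)) ?_ hfg
  exact hg.continuousOn.comp (by fun_prop) fun r hr => ⟨by positivity, pow_le_one₀ hr.1 hr.2⟩

theorem profileMean_eq_radialMean {f₀ f : ℝ → ℝ} (hff : EqOn f f₀ (Icc 0 1)) {r : ℝ}
    (hr : r ∈ Icc (0 : ℝ) 1) : profileMean f₀ r = radialMean 1 f r := by
  unfold profileMean radialMean
  refine intervalIntegral.integral_congr fun s hs => ?_
  rw [uIcc_of_le zero_le_one] at hs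
  simp only [pow_one]
  rw [hff ⟨mul_nonneg hr.1 hs.1, mul_le_one₀ hr.2 hs.1 hs.2⟩]

theorem IsProfile.continuousOn_profileMean {f₀ : ℝ → ℝ} (hf₀ : IsProfile f₀) :
    ContinuousOn (profileMean f₀) (Icc 0 1) := by
  obtain ⟨f, hf, hff⟩ := exists_continuous_eqOn_Icc hf₀.continuousOn
  exact (continuous_radialMean 1 hf).continuousOn.congr fun r hr =>
    profileMean_eq_radialMean hff hr

theorem IsProfile.sub_profileMean_ne_zero {f₀ : ℝ → ℝ} (hf₀ : IsProfile f₀) {Ω : ℝ}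
    (hΩ : Ω ∉ Icc (kappa₁ f₀) (kappa₂ f₀)) {r : ℝ} (hr : r ∈ Icc (0 : ℝ) 1) :
    Ω - profileMean f₀ r ≠ 0 := by
  intro h
  have hc := isCompact_Icc.image_of_continuousOn hf₀.continuousOn_profileMean
  rw [sub_eq_zero.1 h] at hΩ
  exact hΩ ⟨csInf_le hc.bddBelow (mem_image_of_mem _ hr), le_csSup hc.bddAbove (mem_image_of_mem _ hr)⟩

/-- The potential extends continuously to `r = 0`, and then to the whole line. -/
theorem IsProfile.exists_continuous_eq_mu {f₀ : ℝ → ℝ} (hf₀ : IsProfile f₀) {Ω : ℝ}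
    (hΩ : Ω ∉ Icc (kappa₁ f₀) (kappa₂ f₀)) :
    ∃ μ : ℝ → ℝ, Continuous μ ∧ ∀ r ∈ Ioc (0 : ℝ) 1, mu f₀ Ω r = μ r := by
  obtain ⟨g, β, C, -, -, hg, -, hfg⟩ := hf₀.regular
  have hmaps : MapsTo (fun r : ℝ => r ^ 2) (Icc 0 1) (Icc 0 1) := fun r hr =>
    ⟨by positivity, pow_le_one₀ hr.1 hr.2⟩
  have hu := uniqueDiffOn_Icc (zero_lt_one' ℝ)
  -- Since `f₀'(r) = 2 r g'(r²)`, the factor `r` cancels in `mu`; this expression makes sense at 0.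
  have hcont : ContinuousOn
      (fun r => 2 * derivWithin g (Icc 0 1) (r ^ 2) / (Ω - profileMean f₀ r)) (Icc 0 1) := by
    refine ContinuousOn.div ?_ (continuousOn_const.sub hf₀.continuousOn_profileMean)
      fun r hr => hf₀.sub_profileMean_ne_zero hΩ hr
    exact continuousOn_const.mul
      ((hg.continuousOn_derivWithin hu one_le_two).comp (by fun_prop) hmaps)
  obtain ⟨μ, hμ, hμe⟩ := exists_continuous_eqOn_Icc hcont
  refine ⟨μ, hμ, fun r hr => ?_⟩
  have hr' : r ∈ Icc (0 : ℝ) 1 := ⟨hr.1.le, hr.2⟩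
  have hg' : HasDerivWithinAt g (derivWithin g (Icc 0 1) (r ^ 2)) (Icc 0 1) (r ^ 2) :=
    (hg.differentiableOn two_ne_zero _ (hmaps hr')).hasDerivWithinAt
  have hd : HasDerivWithinAt f₀ (derivWithin g (Icc 0 1) (r ^ 2) * (2 * r)) (Icc 0 1) r := by
    refine HasDerivWithinAt.congr ?_ hfg (hfg r hr')
    have h2 : HasDerivWithinAt (fun r : ℝ => r ^ 2) (2 * r) (Icc 0 1) r := by
      simpa using (hasDerivAt_pow 2 r).hasDerivWithinAt
    exact HasDerivWithinAt.comp (h := fun r : ℝ => r ^ 2) r hg' h2 hmaps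
  have hr0 : r ≠ 0 := hr.1.ne'
  have hne := hf₀.sub_profileMean_ne_zero hΩ hr'
  rw [hμe hr', mu, hd.derivWithin (hu r hr')]
  field_simp

theorem isRegularSolution_of_eq_radialInt {f₀ μ y ψ : ℝ → ℝ} {n : ℕ} {Ω : ℝ}
    (hmu : ∀ r ∈ Ioc (0 : ℝ) 1, mu f₀ Ω r = μ r) (hψ : Continuous ψ)
    (hψe : ∀ t ∈ Icc (0 : ℝ) 1, ψ t = 0 - μ t * y t)
    (hy : ∀ t, y t = 1 + radialInt (2 * n + 1) ψ t) : IsRegularSolution f₀ n Ω y := by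
  have hu := uniqueDiffOn_Icc (zero_lt_one' ℝ)
  have hd : ∀ r, HasDerivAt y (r * radialMean (2 * n + 1) ψ r) r := fun r => by
    rw [funext hy]
    exact (hasDerivAt_radialInt _ hψ r).const_add 1
  have hd2 := hasDerivAt_mul_radialMean (2 * n + 1) hψ
  have hderiv : deriv y = fun r => r * radialMean (2 * n + 1) ψ r := funext fun r => (hd r).deriv
  have hcd : ContDiff ℝ 2 y := by
    rw [show (2 : WithTop ℕ∞) = 1 + 1 by norm_num, contDiff_succ_iff_deriv, hderiv,
      contDiff_one_iff_deriv]
    refine ⟨fun r => (hd r).differentiableAt, by simp, fun r => (hd2 r).differentiableAt, ?_⟩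
    rw [funext fun r => (hd2 r).deriv]
    exact hψ.sub (continuous_const.mul (continuous_radialMean _ hψ))
  refine ⟨hcd.contDiffOn, by simp [hy, radialInt], fun r hr => ?_⟩
  have hr' : r ∈ Icc (0 : ℝ) 1 := ⟨hr.1.le, hr.2⟩
  have hdw : EqOn (derivWithin y (Icc 0 1)) (fun r => r * radialMean (2 * n + 1) ψ r) (Icc 0 1) :=
    fun t ht => (hd t).hasDerivWithinAt.derivWithin (hu t ht)
  rw [derivWithin_congr hdw (hdw hr'), hdw hr', (hd2 r).hasDerivWithinAt.derivWithin (hu r hr'),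
    hmu r hr, hψe r hr']
  have hr0 : r ≠ 0 := hr.1.ne'
  push_cast
  field_simp
  ring

/-- Integrate `(r^{2n+1} F')' = -r^{2n+1} μ F` from 0: `F'` is continuous up to 0, so the flux
starts from 0 and no singular solution enters. -/
theorem IsRegularSolution.eq_radialInt {f₀ μ F : ℝ → ℝ} {n : ℕ} {Ω : ℝ}
    (hF : IsRegularSolution f₀ n Ω F) (hμ : Continuous μ)
    (hmu : ∀ r ∈ Ioc (0 : ℝ) 1, mu f₀ Ω r = μ r) :
    ∃ ψ : ℝ → ℝ, Continuous ψ ∧ (∀ t ∈ Icc (0 : ℝ) 1, ψ t = 0 - μ t * F t) ∧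
      ∀ t ∈ Icc (0 : ℝ) 1, F t = 1 + radialInt (2 * n + 1) ψ t := by
  have hu := uniqueDiffOn_Icc (zero_lt_one' ℝ)
  obtain ⟨F', hF'c, hF'⟩ := exists_continuous_eqOn_Icc hF.contDiffOn.continuousOn
  set D := derivWithin F (Icc 0 1) with hD
  have hDc : ContDiffOn ℝ 1 D (Icc 0 1) :=
    hF.contDiffOn.derivWithin hu (by norm_num)
  have hFD : ∀ r ∈ Ioo (0 : ℝ) 1, HasDerivAt F (D r) r := fun r hr =>
    ((hF.contDiffOn.differentiableOn two_ne_zero r (Ioo_subset_Icc_self hr)).hasDerivWithinAt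
      ).hasDerivAt (Icc_mem_nhds hr.1 hr.2)
  have hDD : ∀ r ∈ Ioo (0 : ℝ) 1, HasDerivAt D (derivWithin D (Icc 0 1) r) r := fun r hr =>
    ((hDc.differentiableOn one_ne_zero r (Ioo_subset_Icc_self hr)).hasDerivWithinAt
      ).hasDerivAt (Icc_mem_nhds hr.1 hr.2)
  have hψ : Continuous fun t => 0 - μ t * F' t := by fun_prop
  refine ⟨fun t => 0 - μ t * F' t, hψ, fun t ht => by simp only [hF' ht], ?_⟩
  have hDm : ∀ r ∈ Ioc (0 : ℝ) 1, D r = r * radialMean (2 * n + 1) (fun t => 0 - μ t * F' t) r := by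
    intro r hr
    have h := intervalIntegral.integral_eq_sub_of_hasDerivAt_of_le hr.1.le
      (f := fun t => t ^ (2 * n + 1) * D t) (f' := fun t => t ^ (2 * n + 1) * (0 - μ t * F' t))
      (ContinuousOn.mul (by fun_prop) (hDc.continuousOn.mono (Icc_subset_Icc_right hr.2)))
      (fun t ht => by
        have ht' : t ∈ Ioo (0 : ℝ) 1 := ⟨ht.1, ht.2.trans_le hr.2⟩
        have ht0 : t ≠ 0 := ht.1.ne'
        have hode := hF.ode t (Ioo_subset_Ioc_self ht')
        rw [hmu t (Ioo_subset_Ioc_self ht'), ← hF' (Ioo_subset_Icc_self ht'), ← hD] at hode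
        refine ((hasDerivAt_pow (2 * n + 1) t).mul (hDD t ht')).congr_deriv ?_
        rw [show derivWithin D (Icc 0 1) t = -((2 * n + 1) / t * D t + μ t * F' t) by linarith]
        simp only [Nat.add_sub_cancel]
        push_cast
        field_simp
        ring)
      (Continuous.intervalIntegrable (by fun_prop) _ _)
    rw [← pow_mul_radialMean] at h
    have hr0 : r ≠ 0 := hr.1.ne'
    have hp : r ^ (2 * n + 1) ≠ 0 := pow_ne_zero _ hr0
    apply mul_left_cancel₀ hp
    simp only [zero_pow (Nat.succ_ne_zero (2 * n)), zero_mul, sub_zero] at h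
    rw [← h]
    ring
  intro r hr
  have h := intervalIntegral.integral_eq_sub_of_hasDerivAt_of_le hr.1
    (f := F) (f' := fun t => t * radialMean (2 * n + 1) (fun t => 0 - μ t * F' t) t)
    (hF.contDiffOn.continuousOn.mono (Icc_subset_Icc_right hr.2))
    (fun t ht => by
      have ht' : t ∈ Ioo (0 : ℝ) 1 := ⟨ht.1, ht.2.trans_le hr.2⟩
      rw [← hDm t (Ioo_subset_Ioc_self ht')]
      exact hFD t ht')
    ((continuous_id.mul (continuous_radialMean _ hψ)).intervalIntegrable _ _)
  rw [radialInt, h, hF.init]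
  ring

theorem IsRegularSolution.eqOn {f₀ F₁ F₂ : ℝ → ℝ} (hf₀ : IsProfile f₀) {n : ℕ} {Ω : ℝ}
    (hΩ : Ω ∉ Icc (kappa₁ f₀) (kappa₂ f₀)) (h₁ : IsRegularSolution f₀ n Ω F₁)
    (h₂ : IsRegularSolution f₀ n Ω F₂) : EqOn F₁ F₂ (Icc 0 1) := by
  obtain ⟨μ, hμ, hmu⟩ := hf₀.exists_continuous_eq_mu hΩ
  obtain ⟨ψ₁, c₁, e₁, i₁⟩ := h₁.eq_radialInt hμ hmu
  obtain ⟨ψ₂, c₂, e₂, i₂⟩ := h₂.eq_radialInt hμ hmu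
  exact eqOn_of_eq_radialInt _ (φ := fun _ => 0) hμ c₁ c₂ e₁ e₂ i₁ i₂

theorem isRegularSolution_generator {f₀ : ℝ → ℝ} (hf₀ : IsProfile f₀) (n : ℕ) {Ω : ℝ}
    (hΩ : Ω ∉ Icc (kappa₁ f₀) (kappa₂ f₀)) : IsRegularSolution f₀ n Ω (generator f₀ n Ω) := by
  obtain ⟨μ, hμ, hmu⟩ := hf₀.exists_continuous_eq_mu hΩ
  obtain ⟨y, ψ, hψ, hψe, hy⟩ :=
    exists_eq_radialInt (2 * n + 1) (φ := fun _ => 0) continuous_const hμ 1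
  exact Classical.epsilon_spec ⟨y, isRegularSolution_of_eq_radialInt hmu hψ hψe hy⟩

/-! ### The radial system, Green's identity and backward uniqueness -/

/-- `(y, P)` solves `r^N y' = P`, `P' = r^N (φ - μ y)` on `(0,1]`. -/
structure IsRadialPair (N : ℕ) (μ φ y P : ℝ → ℝ) : Prop where
  deriv_fst : ∀ r ∈ Ioc (0 : ℝ) 1, HasDerivAt y (P r / r ^ N) r
  deriv_snd : ∀ r ∈ Ioc (0 : ℝ) 1, HasDerivAt P (r ^ N * (φ r - μ r * y r)) r

theorem exists_isRadialPair (N : ℕ) {φ μ : ℝ → ℝ} (hφ : Continuous φ) (hμ : Continuous μ) (a : ℝ) :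
    ∃ y ψ : ℝ → ℝ, Continuous y ∧ Continuous ψ ∧ (∀ t ∈ Icc (0 : ℝ) 1, ψ t = φ t - μ t * y t) ∧
      (∀ t, y t = a + radialInt N ψ t) ∧
      IsRadialPair N μ φ y fun r => r ^ (N + 1) * radialMean N ψ r := by
  obtain ⟨y, ψ, hψ, hψe, hy⟩ := exists_eq_radialInt N hφ hμ a
  have hd : ∀ r, HasDerivAt y (r * radialMean N ψ r) r := fun r => by
    rw [funext hy]
    exact (hasDerivAt_radialInt _ hψ r).const_add a
  refine ⟨y, ψ, continuous_iff_continuousAt.2 fun r => (hd r).continuousAt, hψ, hψe, hy,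
    fun r hr => ?_, fun r hr => ?_⟩
  · refine HasDerivAt.congr_deriv (hd r) ?_
    have hr0 : r ≠ 0 := hr.1.ne'
    field_simp
    ring
  · rw [← hψe r (Ioc_subset_Icc_self hr), funext (pow_mul_radialMean N ψ)]
    exact hasDerivAt_integral_pow_mul N hψ r

theorem IsRadialPair.add_const_mul {N : ℕ} {μ φ y P F Q : ℝ → ℝ} (hy : IsRadialPair N μ φ y P)
    (hF : IsRadialPair N μ (fun _ => 0) F Q) (b : ℝ) :
    IsRadialPair N μ φ (fun r => y r + b * F r) (fun r => P r + b * Q r) where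
  deriv_fst r hr := by
    refine HasDerivAt.congr_deriv ((hy.deriv_fst r hr).add ((hF.deriv_fst r hr).const_mul b)) ?_
    ring
  deriv_snd r hr := by
    refine HasDerivAt.congr_deriv ((hy.deriv_snd r hr).add ((hF.deriv_snd r hr).const_mul b)) ?_
    ring

/-- Green's identity between an inhomogeneous and a homogeneous solution. -/
theorem IsRadialPair.integral_eq_wronskian {N : ℕ} {μ φ y P F Q : ℝ → ℝ}
    (hy : IsRadialPair N μ φ y P) (hF : IsRadialPair N μ (fun _ => 0) F Q) (hφ : Continuous φ)
    (hFc : Continuous F) (h0 : Tendsto (fun r => P r * F r - y r * Q r) (𝓝[>] 0) (𝓝 0)) :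
    ∫ s in (0 : ℝ)..1, s ^ N * φ s * F s = P 1 * F 1 - y 1 * Q 1 := by
  -- The `μ` terms and the products of the two fluxes cancel, leaving only the source.
  have hd : ∀ r ∈ Ioc (0 : ℝ) 1,
      HasDerivAt (fun r => P r * F r - y r * Q r) (r ^ N * φ r * F r) r := by
    intro r hr
    refine HasDerivAt.congr_deriv (((hy.deriv_snd r hr).mul (hF.deriv_fst r hr)).sub
      ((hy.deriv_fst r hr).mul (hF.deriv_snd r hr))) ?_
    have hr0 : r ≠ 0 := hr.1.ne'
    field_simp
    ring
  have := intervalIntegral.integral_eq_sub_of_hasDerivAt_of_tendsto zero_lt_one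
    (fun r hr => hd r (Ioo_subset_Ioc_self hr))
    (Continuous.intervalIntegrable (by fun_prop) _ _) h0
    ((hd 1 ⟨zero_lt_one, le_rfl⟩).continuousAt.tendsto.mono_left nhdsWithin_le_nhds)
  rw [this, sub_zero]

/-- A homogeneous solution with vanishing Cauchy data at `r = 1` vanishes. -/
theorem IsRadialPair.eq_zero_of_cauchy {N : ℕ} {μ y P : ℝ → ℝ} (hμ : Continuous μ)
    (hy : IsRadialPair N μ (fun _ => 0) y P) (hy1 : y 1 = 0) (hP1 : P 1 = 0) {r : ℝ}
    (hr : r ∈ Ioc (0 : ℝ) 1) : y r = 0 := by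
  obtain ⟨L, hL⟩ := exists_abs_le_of_continuous hμ
  have hr0 : 0 < r := hr.1
  have hrN : 0 < r ^ N := pow_pos hr0 N
  have hL0 : 0 ≤ L := (abs_nonneg _).trans (hL 0 ⟨le_rfl, zero_le_one⟩)
  -- On `[r,1]` the system is Lipschitz: `1/r^N` bounds the coefficient of the flux, `L` that of the
  -- amplitude.
  let K : ℝ≥0 := ⟨L + 1 / r ^ N, by positivity⟩
  have hK : (K : ℝ) = L + 1 / r ^ N := rfl
  let v : ℝ → ℝ × ℝ → ℝ × ℝ := fun t p => (p.2 / t ^ N, t ^ N * (0 - μ t * p.1))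
  have hv : ∀ t ∈ Ioc r 1, LipschitzOnWith K (v t) univ := by
    intro t ht
    have ht0 : 0 < t := hr0.trans ht.1
    rw [lipschitzOnWith_univ]
    refine LipschitzWith.of_dist_le_mul fun p q => ?_
    rw [Prod.dist_eq, hK]
    refine max_le ?_ ?_
    · calc dist (p.2 / t ^ N) (q.2 / t ^ N) = 1 / t ^ N * dist p.2 q.2 := by
            rw [Real.dist_eq, Real.dist_eq, ← sub_div, abs_div, abs_of_pos (pow_pos ht0 N)]
            ring
        _ ≤ (L + 1 / r ^ N) * dist p q := by
            refine mul_le_mul ?_ (le_max_right _ _) dist_nonneg (by positivity)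
            have : 1 / t ^ N ≤ 1 / r ^ N := one_div_le_one_div_of_le hrN (by gcongr; exact ht.1.le)
            linarith
    · calc dist (t ^ N * (0 - μ t * p.1)) (t ^ N * (0 - μ t * q.1))
            = t ^ N * |μ t| * dist p.1 q.1 := by
            rw [Real.dist_eq, Real.dist_eq, ← mul_sub, abs_mul, abs_of_pos (pow_pos ht0 N),
              show 0 - μ t * p.1 - (0 - μ t * q.1) = -(μ t * (p.1 - q.1)) by ring, abs_neg, abs_mul]
            ring
        _ ≤ (L + 1 / r ^ N) * dist p q := by
            refine mul_le_mul ?_ (le_max_left _ _) dist_nonneg (by positivity)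
            have h1 : t ^ N * |μ t| ≤ 1 * L :=
              mul_le_mul (pow_le_one₀ ht0.le ht.2) (hL t ⟨ht0.le, ht.2⟩) (abs_nonneg _) zero_le_one
            have : 0 < 1 / r ^ N := by positivity
            linarith
  have hd : ∀ t ∈ Icc r 1, HasDerivAt (fun t => (y t, P t)) (v t (y t, P t)) t := fun t ht =>
    (hy.deriv_fst t ⟨hr0.trans_le ht.1, ht.2⟩).prodMk (hy.deriv_snd t ⟨hr0.trans_le ht.1, ht.2⟩)
  have h := ODE_solution_unique_of_mem_Icc_left (v := v) (s := fun _ => univ) (K := K)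
    (f := fun t => (y t, P t)) (g := fun _ => 0) hv
    (fun t ht => (hd t ht).continuousAt.continuousWithinAt)
    (fun t ht => (hd t (Ioc_subset_Icc_self ht)).hasDerivWithinAt) (fun _ _ => mem_univ _)
    continuousOn_const
    (fun t _ => by
      have : v t 0 = 0 := by simp [v]
      rw [this]
      exact hasDerivWithinAt_const _ _ _) (fun _ _ => mem_univ _)
    (by simp [hy1, hP1])
  exact congrArg Prod.fst (h ⟨le_rfl, hr.2⟩)

/-! ### From the kernel equation to the radial system -/

/-- `r^{-2n} (H_n[h](r) - c r^{n+1} G_n(r))`, the amplitude of the kernel equation. -/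
noncomputable def kernelAmplitude (f h : ℝ → ℝ) (Ω c : ℝ) (n : ℕ) (r : ℝ) : ℝ :=
  (∫ s in r..1, s ^ (1 - (n : ℤ)) * h s) + (∫ s in (0 : ℝ)..r, s ^ (n + 1) * h s) / r ^ (2 * n)
    - c * (n * Ω * r ^ 2 + (∫ s in (0 : ℝ)..1, s * f s)
      - (n + 1) * (∫ s in (0 : ℝ)..r, s * f s)
      + (n + 1) * ((∫ s in (0 : ℝ)..r, s ^ (2 * n + 1) * f s) / r ^ (2 * n)))

/-- The flux `r^{2n+1} y'` of the amplitude `y` of the kernel equation. -/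
noncomputable def kernelFlux (f h : ℝ → ℝ) (Ω c : ℝ) (n : ℕ) (r : ℝ) : ℝ :=
  -(2 * n) * (∫ s in (0 : ℝ)..r, s ^ (n + 1) * h s)
    - c * (2 * n * Ω * r ^ (2 * n + 2)
      - 2 * n * (n + 1) * ∫ s in (0 : ℝ)..r, s ^ (2 * n + 1) * f s)

theorem Hop_sub_Gfun (f h : ℝ → ℝ) (Ω c : ℝ) {n : ℕ} (hn : 1 ≤ n) {r : ℝ} (hr : 0 < r) :
    Hop n h r - c * (r ^ (n + 1) * Gfun f Ω n r) = r ^ (2 * n) * kernelAmplitude f h Ω c n r := by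
  obtain ⟨m, rfl⟩ : ∃ m, n = m + 1 := ⟨n - 1, by omega⟩
  have hr0 : r ≠ 0 := hr.ne'
  unfold Hop Gfun kernelAmplitude
  simp only [Nat.add_sub_cancel]
  field_simp
  ring

theorem hasDerivAt_integral_zpow_mul {h : ℝ → ℝ} (hh : Continuous h) (k : ℤ) {r : ℝ} (hr : 0 < r) :
    HasDerivAt (fun r => ∫ s in r..1, s ^ k * h s) (-(r ^ k * h r)) r := by
  have hc : ContinuousOn (fun s : ℝ => s ^ k * h s) (Ioi 0) :=
    (continuousOn_zpow₀ k).mono (fun s (hs : 0 < s) => hs.ne') |>.mul hh.continuousOn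
  refine intervalIntegral.integral_hasDerivAt_left
    (hc.mono fun s hs => (lt_min hr one_pos).trans_le hs.1).intervalIntegrable
    (hc.stronglyMeasurableAtFilter isOpen_Ioi r hr) (hc.continuousAt (Ioi_mem_nhds hr))

theorem hasDerivAt_integral_mul {f : ℝ → ℝ} (hf : Continuous f) (r : ℝ) :
    HasDerivAt (fun r => ∫ t in (0 : ℝ)..r, t * f t) (r * f r) r := by
  simpa using hasDerivAt_integral_pow_mul 1 hf r

/-- The pointwise values of `h` and of `f` cancel between the integrals; what remains comes from
differentiating `r^{-2n}` and `r²`. -/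
theorem hasDerivAt_kernelAmplitude {f h : ℝ → ℝ} (hf : Continuous f) (hh : Continuous h)
    (Ω c : ℝ) {n : ℕ} (hn : 1 ≤ n) {r : ℝ} (hr : 0 < r) :
    HasDerivAt (kernelAmplitude f h Ω c n) (kernelFlux f h Ω c n r / r ^ (2 * n + 1)) r := by
  have hr0 : r ≠ 0 := hr.ne'
  have hp := hasDerivAt_pow (2 * n) r
  have hp0 : r ^ (2 * n) ≠ 0 := pow_ne_zero _ hr0
  refine HasDerivAt.congr_deriv (((hasDerivAt_integral_zpow_mul hh (1 - (n : ℤ)) hr).add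
    ((hasDerivAt_integral_pow_mul (n + 1) hh r).div hp hp0)).sub
    ((((((hasDerivAt_pow 2 r).const_mul ((n : ℝ) * Ω)).add_const _).sub
      ((hasDerivAt_integral_mul hf r).const_mul ((n : ℝ) + 1))).add
      (((hasDerivAt_integral_pow_mul (2 * n + 1) hf r).div hp hp0).const_mul
        ((n : ℝ) + 1))).const_mul c)) ?_
  obtain ⟨m, rfl⟩ : ∃ m, n = m + 1 := ⟨n - 1, by omega⟩
  have hz : r ^ (1 - ((m + 1 : ℕ) : ℤ)) = (r ^ m)⁻¹ := by
    rw [← zpow_natCast, ← zpow_neg]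
    congr 1
    push_cast
    ring
  rw [hz, show 2 * (m + 1) - 1 = 2 * m + 1 by omega]
  unfold kernelFlux
  push_cast
  field_simp
  ring

theorem hasDerivAt_kernelFlux {f h : ℝ → ℝ} (hf : Continuous f) (hh : Continuous h)
    (Ω c : ℝ) (n : ℕ) (r : ℝ) :
    HasDerivAt (kernelFlux f h Ω c n)
      (-(2 * n) * (r ^ (n + 1) * h r) + r ^ (2 * n + 1) * (2 * n * (n + 1) * c * (f r - 2 * Ω))) r := by
  refine HasDerivAt.congr_deriv (((hasDerivAt_integral_pow_mul (n + 1) hh r).const_mul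
    (-(2 * (n : ℝ)))).sub ((((hasDerivAt_pow (2 * n + 2) r).const_mul (2 * (n : ℝ) * Ω)).sub
    ((hasDerivAt_integral_pow_mul (2 * n + 1) hf r).const_mul
      (2 * (n : ℝ) * (n + 1)))).const_mul c)) ?_
  simp only [Nat.add_succ_sub_one]
  push_cast
  ring

theorem abs_pow_mul_integral_zpow_le {h : ℝ → ℝ} {B : ℝ} (hB : ∀ t ∈ Icc (0 : ℝ) 1, |h t| ≤ B)
    (n : ℕ) {r : ℝ} (hr : r ∈ Ioc (0 : ℝ) 1) :
    |r ^ (2 * n + 2) * ∫ s in r..1, s ^ (1 - (n : ℤ)) * h s| ≤ r ^ 2 * B := by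
  have hr0 := hr.1
  have hB0 : 0 ≤ B := (abs_nonneg _).trans (hB 0 ⟨le_rfl, zero_le_one⟩)
  have hI : |∫ s in r..1, s ^ (1 - (n : ℤ)) * h s| ≤ (r ^ n)⁻¹ * B * |1 - r| := by
    rw [← Real.norm_eq_abs]
    refine intervalIntegral.norm_integral_le_of_norm_le_const fun s hs => ?_
    rw [uIoc_of_le hr.2] at hs
    have hs0 : 0 < s := hr0.trans hs.1
    rw [Real.norm_eq_abs, abs_mul, abs_of_pos (zpow_pos hs0 _)]
    refine mul_le_mul ?_ (hB s ⟨hs0.le, hs.2⟩) (abs_nonneg _) (by positivity)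
    rw [sub_eq_add_neg, zpow_add₀ hs0.ne', zpow_one, zpow_neg, zpow_natCast]
    calc s * (s ^ n)⁻¹ ≤ 1 * (r ^ n)⁻¹ := by
          gcongr
          · exact hs.2
          · exact hs.1.le
      _ = (r ^ n)⁻¹ := one_mul _
  have h1 : |1 - r| ≤ 1 := by rw [abs_of_nonneg (by linarith [hr.2])]; linarith
  rw [abs_mul, abs_of_pos (by positivity)]
  calc r ^ (2 * n + 2) * |∫ s in r..1, s ^ (1 - (n : ℤ)) * h s|
      ≤ r ^ (2 * n + 2) * ((r ^ n)⁻¹ * B * 1) := by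
        gcongr
        exact hI.trans (by gcongr)
    _ = r ^ n * (r ^ 2 * B) := by field_simp; ring
    _ ≤ 1 * (r ^ 2 * B) := by
        gcongr
        exact pow_le_one₀ hr0.le hr.2
    _ = r ^ 2 * B := one_mul _

/-- The amplitude need not be bounded at 0, but in Green's identity it meets the flux of `F`, which
carries the factor `r^{2n+2}`. -/
theorem tendsto_pow_mul_kernelAmplitude {f h : ℝ → ℝ} (hf : Continuous f) (hh : Continuous h)
    (Ω c : ℝ) (n : ℕ) :
    Tendsto (fun r => r ^ (2 * n + 2) * kernelAmplitude f h Ω c n r) (𝓝[>] 0) (𝓝 0) := by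
  obtain ⟨B, hB⟩ := exists_abs_le_of_continuous hh
  have hpos : ∀ᶠ r : ℝ in 𝓝[>] 0, r ∈ Ioc (0 : ℝ) 1 := Ioc_mem_nhdsGT one_pos
  have hc : ∀ (N : ℕ) {ψ : ℝ → ℝ}, Continuous ψ →
      Continuous fun r => ∫ t in (0 : ℝ)..r, t ^ N * ψ t := fun N ψ hψ =>
    continuous_iff_continuousAt.2 fun r => (hasDerivAt_integral_pow_mul N hψ r).continuousAt
  have h1 : Tendsto (fun r => r ^ (2 * n + 2) * ∫ s in r..1, s ^ (1 - (n : ℤ)) * h s)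
      (𝓝[>] 0) (𝓝 0) := by
    refine squeeze_zero_norm' (a := fun r => r ^ 2 * B)
      (hpos.mono fun r hr => abs_pow_mul_integral_zpow_le hB n hr) ?_
    have : Continuous fun r : ℝ => r ^ 2 * B := by fun_prop
    simpa using (this.tendsto 0).mono_left nhdsWithin_le_nhds
  have hA := hc (n + 1) hh
  have hJ := hc (2 * n + 1) hf
  have hI : Continuous fun r => ∫ t in (0 : ℝ)..r, t * f t := by simpa using hc 1 hf
  have h2 : Tendsto (fun r => r ^ 2 * (∫ s in (0 : ℝ)..r, s ^ (n + 1) * h s)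
      - c * (r ^ (2 * n + 2) * (n * Ω * r ^ 2 + (∫ s in (0 : ℝ)..1, s * f s)
      - (n + 1) * (∫ s in (0 : ℝ)..r, s * f s))
      + r ^ 2 * ((n + 1) * (∫ s in (0 : ℝ)..r, s ^ (2 * n + 1) * f s)))) (𝓝[>] 0) (𝓝 0) := by
    have : Continuous fun r => r ^ 2 * (∫ s in (0 : ℝ)..r, s ^ (n + 1) * h s)
      - c * (r ^ (2 * n + 2) * (n * Ω * r ^ 2 + (∫ s in (0 : ℝ)..1, s * f s)
      - (n + 1) * (∫ s in (0 : ℝ)..r, s * f s))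
      + r ^ 2 * ((n + 1) * (∫ s in (0 : ℝ)..r, s ^ (2 * n + 1) * f s))) := by fun_prop
    simpa using (this.tendsto 0).mono_left nhdsWithin_le_nhds
  have h3 := h1.add h2
  rw [add_zero] at h3
  refine h3.congr' (hpos.mono fun r hr => ?_)
  have hr0 : r ≠ 0 := hr.1.ne'
  unfold kernelAmplitude
  field_simp
  ring

theorem Gfun_one (f : ℝ → ℝ) (Ω : ℝ) {n : ℕ} (hn : 1 ≤ n) :
    Gfun f Ω n 1 = n * (Ω - omegaHat f n) := by
  have : (n : ℝ) ≠ 0 := by positivity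
  unfold Gfun omegaHat
  simp only [one_pow]
  field_simp
  ring

/-- A solution of the kernel equation vanishes as soon as the dispersion function does not. -/
theorem eq_zero_of_kernelEq {f h μ F ψ : ℝ → ℝ} {Ω : ℝ} {n : ℕ} (hn : 1 ≤ n)
    (hf : Continuous f) (hh : Continuous h) (hμ : Continuous μ) (hF : Continuous F)
    (hψ : Continuous ψ) (hFp : IsRadialPair (2 * n + 1) μ (fun _ => 0) F
      fun r => r ^ (2 * n + 1 + 1) * radialMean (2 * n + 1) ψ r)
    (hG : Gfun f Ω n 1 ≠ 0)
    (heq : ∀ r ∈ Ioc (0 : ℝ) 1, h r - μ r / (2 * n * r ^ n) * Hop n h r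
      = -(Hop n h 1 / (2 * n * Gfun f Ω n 1)) * μ r * r * Gfun f Ω n r)
    (hζ : F 1 * (Ω - (n : ℝ) / (n + 1) * ∫ s in (0 : ℝ)..1, s * f s)
      + ∫ s in (0 : ℝ)..1, F s * s ^ (2 * n + 1) * (f s - 2 * Ω) ≠ 0) :
    ∀ r ∈ Ioc (0 : ℝ) 1, h r = 0 := by
  have hn0 : (n : ℝ) ≠ 0 := by positivity
  have hn1 : (n : ℝ) + 1 ≠ 0 := by positivity
  obtain ⟨c, hc⟩ : ∃ c, c = Hop n h 1 / Gfun f Ω n 1 := ⟨_, rfl⟩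
  have hH1 : Hop n h 1 = c * Gfun f Ω n 1 := by rw [hc]; field_simp
  set y := kernelAmplitude f h Ω c n with hy
  set P := kernelFlux f h Ω c n with hP
  have hhy : ∀ r ∈ Ioc (0 : ℝ) 1, h r = μ r * r ^ n * y r / (2 * n) := by
    intro r hr
    have hr0 : r ≠ 0 := hr.1.ne'
    have h1 := Hop_sub_Gfun f h Ω c hn hr.1
    have h2 := heq r hr
    have h3 : Hop n h r = r ^ (2 * n) * y r + c * (r ^ (n + 1) * Gfun f Ω n r) := by
      rw [hy, ← h1]; ring
    rw [h3, hH1] at h2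
    have h4 : h r = μ r / (2 * n * r ^ n) * (r ^ (2 * n) * y r + c * (r ^ (n + 1) * Gfun f Ω n r))
        + -(c * Gfun f Ω n 1 / (2 * n * Gfun f Ω n 1)) * μ r * r * Gfun f Ω n r := by
      linarith
    rw [h4]
    field_simp
    ring
  have hpair : IsRadialPair (2 * n + 1) μ (fun r => 2 * n * (n + 1) * c * (f r - 2 * Ω)) y P :=
    { deriv_fst := fun r hr => hasDerivAt_kernelAmplitude hf hh Ω c hn hr.1
      deriv_snd := fun r hr => by
        refine (hasDerivAt_kernelFlux hf hh Ω c n r).congr_deriv ?_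
        rw [hhy r hr]
        field_simp
        ring }
  have hy1 : y 1 = 0 := by
    have := Hop_sub_Gfun f h Ω c hn one_pos
    simp only [one_pow, one_mul] at this
    rw [hy, ← this, hH1, sub_self]
  -- At 1 the first integral in `H_n` is empty, so the remaining one equals `c G_n(1)`; the terms in
  -- `∫ s^{2n+1} f` then cancel.
  have hP1 : P 1 = -(2 * n * (n + 1) * c) * (Ω - (n : ℝ) / (n + 1) * ∫ s in (0 : ℝ)..1, s * f s) := by
    have hA : ∫ s in (0 : ℝ)..1, s ^ (n + 1) * h s = c * Gfun f Ω n 1 := by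
      rw [← hH1]; simp [Hop]
    rw [hP, kernelFlux, hA, Gfun]
    simp only [one_pow]
    field_simp
    ring
  have hP0 : Tendsto P (𝓝[>] 0) (𝓝 0) := by
    have h0 : P 0 = 0 := by simp [hP, kernelFlux]
    have := (hasDerivAt_kernelFlux hf hh Ω c n 0).continuousAt.tendsto
    rw [← hP, h0] at this
    exact this.mono_left nhdsWithin_le_nhds
  have hw : Tendsto (fun r => P r * F r - y r * (r ^ (2 * n + 1 + 1) * radialMean (2 * n + 1) ψ r))
      (𝓝[>] 0) (𝓝 0) := by
    have h1 := hP0.mul ((hF.tendsto 0).mono_left (nhdsWithin_le_nhds (s := Ioi 0)))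
    have h2 := (tendsto_pow_mul_kernelAmplitude hf hh Ω c n).mul
      (((continuous_radialMean (2 * n + 1) hψ).tendsto 0).mono_left
        (nhdsWithin_le_nhds (s := Ioi 0)))
    have h3 := h1.sub h2
    simp only [zero_mul, sub_zero] at h3
    refine h3.congr fun r => ?_
    rw [← hy]
    ring
  have hgreen := hpair.integral_eq_wronskian hFp (by fun_prop) hF hw
  rw [hy1, hP1, zero_mul, sub_zero] at hgreen
  have hint : ∫ s in (0 : ℝ)..1, s ^ (2 * n + 1) * (2 * n * (n + 1) * c * (f s - 2 * Ω)) * F s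
      = 2 * n * (n + 1) * c * ∫ s in (0 : ℝ)..1, F s * s ^ (2 * n + 1) * (f s - 2 * Ω) := by
    rw [← intervalIntegral.integral_const_mul]
    congr 1
    ext s
    ring
  rw [hint] at hgreen
  -- Green's identity is now `2n(n+1) c` times the dispersion function equal to 0.
  have hc0 : c = 0 := by
    have : 2 * n * (n + 1) * c * (F 1 * (Ω - (n : ℝ) / (n + 1) * ∫ s in (0 : ℝ)..1, s * f s)
      + ∫ s in (0 : ℝ)..1, F s * s ^ (2 * n + 1) * (f s - 2 * Ω)) = 0 := by
      linear_combination hgreen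
    simpa [hζ, hn0, hn1] using this
  have hpair0 : IsRadialPair (2 * n + 1) μ (fun _ => 0) y P := by
    simpa [hc0] using hpair
  intro r hr
  rw [hhy r hr, hpair0.eq_zero_of_cauchy hμ hy1 (by simp [hP1, hc0]) hr]
  simp

/-! ### From the radial system back to the kernel equation -/

/-- Where the dispersion function vanishes, the inhomogeneous problem has a regular solution with
the Cauchy data at `r = 1` that the kernel equation prescribes. -/
theorem exists_isRadialPair_of_dispersion {φ μ F ψ : ℝ → ℝ} {N : ℕ} {p : ℝ} (hφ : Continuous φ)
    (hμ : Continuous μ) (hF : Continuous F) (hψ : Continuous ψ) (hF0 : F 0 = 1)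
    (hFp : IsRadialPair N μ (fun _ => 0) F fun r => r ^ (N + 1) * radialMean N ψ r)
    (hp : ∫ s in (0 : ℝ)..1, s ^ N * φ s * F s = p * F 1) :
    ∃ y P : ℝ → ℝ, Continuous y ∧ Continuous P ∧ P 0 = 0 ∧ y 1 = 0 ∧ P 1 = p ∧
      IsRadialPair N μ φ y P := by
  obtain ⟨y, χ, hy, hχ, -, -, hyp⟩ := exists_isRadialPair N hφ hμ 0
  have hmψ := continuous_radialMean N hψ
  have hmχ := continuous_radialMean N hχ
  have hgreen := hyp.integral_eq_wronskian hFp hφ hF (by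
    have : Continuous fun r => r ^ (N + 1) * radialMean N χ r * F r
      - y r * (r ^ (N + 1) * radialMean N ψ r) := by fun_prop
    simpa using (this.tendsto 0).mono_left nhdsWithin_le_nhds)
  rw [hp] at hgreen
  simp only [one_pow, one_mul] at hgreen
  -- One constant must meet two conditions at 1; `hgreen` makes them compatible.
  suffices h : ∃ b, y 1 + b * F 1 = 0 ∧ radialMean N χ 1 + b * radialMean N ψ 1 = p by
    obtain ⟨b, hb1, hb2⟩ := h
    refine ⟨_, _, ?_, ?_, ?_, hb1, ?_, hyp.add_const_mul hFp b⟩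
    · fun_prop
    · fun_prop
    · simp
    · simpa using hb2
  by_cases hF1 : F 1 = 0
  · have hψ1 : radialMean N ψ 1 ≠ 0 := by
      intro h0
      have hz : ∀ r ∈ Ioc (0 : ℝ) 1, F r = 0 := fun r hr =>
        hFp.eq_zero_of_cauchy hμ hF1 (by simp [h0]) hr
      have h1 : Tendsto F (𝓝[>] 0) (𝓝 1) := hF0 ▸ (hF.tendsto 0).mono_left nhdsWithin_le_nhds
      have h2 : Tendsto F (𝓝[>] 0) (𝓝 0) := tendsto_const_nhds.congr'
        (by filter_upwards [Ioc_mem_nhdsGT one_pos] with r hr using (hz r hr).symm)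
      exact one_ne_zero (tendsto_nhds_unique h1 h2)
    have hy1 : y 1 = 0 := by
      rw [hF1] at hgreen
      have : y 1 * radialMean N ψ 1 = 0 := by linarith
      simpa [hψ1] using this
    exact ⟨(p - radialMean N χ 1) / radialMean N ψ 1, by simp [hy1, hF1], by field_simp; ring⟩
  · refine ⟨-y 1 / F 1, by field_simp; ring, ?_⟩
    field_simp
    linear_combination -hgreen

/-- The kernel equation holds for `h = μ r^n y / (2n)` when the amplitude `y` solves the
inhomogeneous problem. -/
theorem Hop_of_isRadialPair {f μ y P : ℝ → ℝ} {Ω : ℝ} {n : ℕ} (hn : 1 ≤ n)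
    (hf : Continuous f) (hμ : Continuous μ) (hy : Continuous y) (hP : Continuous P) (hP0 : P 0 = 0)
    (hy1 : y 1 = 0)
    (hP1 : P 1 = -(2 * n * (n + 1)) * (Ω - (n : ℝ) / (n + 1) * ∫ s in (0 : ℝ)..1, s * f s))
    (hpair : IsRadialPair (2 * n + 1) μ (fun r => 2 * n * (n + 1) * (f r - 2 * Ω)) y P)
    {r : ℝ} (hr : r ∈ Ioc (0 : ℝ) 1) :
    Hop n (fun r => μ r * r ^ n * y r / (2 * n)) r
      = r ^ (n + 1) * Gfun f Ω n r + r ^ (2 * n) * y r := by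
  have hn0 : (n : ℝ) ≠ 0 := by positivity
  have hn1 : (n : ℝ) + 1 ≠ 0 := by positivity
  have hr0 : r ≠ 0 := hr.1.ne'
  have hJc : Continuous fun r => ∫ s in (0 : ℝ)..r, s ^ (2 * n + 1) * f s :=
    continuous_iff_continuousAt.2 fun r => (hasDerivAt_integral_pow_mul _ hf r).continuousAt
  -- The primitive is read off the flux equation `P' = s^{2n+1}(φ - μ y)` divided by `2n`.
  have hA := intervalIntegral.integral_eq_sub_of_hasDerivAt_of_le hr.1.le
    (f := fun t => (n + 1) * (∫ s in (0 : ℝ)..t, s ^ (2 * n + 1) * f s) - Ω * t ^ (2 * n + 2)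
      - P t / (2 * n))
    (f' := fun s => s ^ (n + 1) * (μ s * s ^ n * y s / (2 * n)))
    (by fun_prop)
    (fun t ht => by
      refine HasDerivAt.congr_deriv ((((hasDerivAt_integral_pow_mul _ hf t).const_mul _).sub
        ((hasDerivAt_pow (2 * n + 2) t).const_mul Ω)).sub
        ((hpair.deriv_snd t ⟨ht.1, ht.2.le.trans hr.2⟩).div_const _)) ?_
      simp only [Nat.add_succ_sub_one]
      push_cast
      field_simp
      ring)
    (Continuous.intervalIntegrable (by fun_prop) _ _)
  -- Divide the same equation by `2n s^{2n}`: as `P = s^{2n+1} y'`, the term `P'/(2n s^{2n})` is the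
  -- derivative of `P/(2n s^{2n}) + y`.
  have hB := intervalIntegral.integral_eq_sub_of_hasDerivAt (a := r) (b := 1)
    (f := fun t => (n + 1) * ((∫ s in (0 : ℝ)..t, s * f s) - Ω * t ^ 2)
      - (P t / t ^ (2 * n) / (2 * n) + y t))
    (f' := fun s => s * μ s * y s / (2 * n))
    (fun t ht => by
      rw [uIcc_of_le hr.2] at ht
      have ht0 : 0 < t := hr.1.trans_le ht.1
      have ht1 : t ∈ Ioc (0 : ℝ) 1 := ⟨ht0, ht.2⟩
      refine HasDerivAt.congr_deriv ((((hasDerivAt_integral_mul hf t).sub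
        ((hasDerivAt_pow 2 t).const_mul Ω)).const_mul _).sub
        ((((hpair.deriv_snd t ht1).div (hasDerivAt_pow (2 * n) t)
          (pow_ne_zero _ ht0.ne')).div_const _).add (hpair.deriv_fst t ht1))) ?_
      obtain ⟨m, rfl⟩ : ∃ m, n = m + 1 := ⟨n - 1, by omega⟩
      rw [show 2 * (m + 1) - 1 = 2 * m + 1 by omega]
      push_cast at hn0 ⊢
      field_simp
      ring)
    (Continuous.intervalIntegrable (by fun_prop) _ _)
  have hBeq : ∫ s in r..1, s ^ (1 - (n : ℤ)) * (μ s * s ^ n * y s / (2 * n))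
      = ∫ s in r..1, s * μ s * y s / (2 * n) := by
    refine intervalIntegral.integral_congr fun s hs => ?_
    rw [uIcc_of_le hr.2] at hs
    have hs0 : s ≠ 0 := (hr.1.trans_le hs.1).ne'
    rw [sub_eq_add_neg, zpow_add₀ hs0, zpow_one, zpow_neg, zpow_natCast]
    field_simp
  unfold Hop
  rw [hBeq, hB, hA, hP1, hP0, hy1, Gfun]
  obtain ⟨m, rfl⟩ : ∃ m, n = m + 1 := ⟨n - 1, by omega⟩
  simp only [Nat.add_sub_cancel, intervalIntegral.integral_same, one_pow]
  push_cast at hn0 hn1 ⊢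
  field_simp
  ring

/-! ### The equivalence on the unit interval -/

theorem intervalIntegral_mul_congr {f g w : ℝ → ℝ} (hfg : EqOn f g (Icc 0 1)) {a b : ℝ}
    (ha : a ∈ Icc (0 : ℝ) 1) (hb : b ∈ Icc (0 : ℝ) 1) :
    ∫ s in a..b, w s * f s = ∫ s in a..b, w s * g s :=
  intervalIntegral.integral_congr fun s hs => by
    simp only [hfg (uIcc_subset_Icc ha hb hs)]

theorem Hop_congr {h k : ℝ → ℝ} (hk : EqOn h k (Icc 0 1)) (n : ℕ) {r : ℝ}
    (hr : r ∈ Icc (0 : ℝ) 1) : Hop n h r = Hop n k r := by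
  unfold Hop
  rw [intervalIntegral_mul_congr hk hr ⟨zero_le_one, le_rfl⟩,
    intervalIntegral_mul_congr hk ⟨le_rfl, zero_le_one⟩ hr]

theorem Gfun_congr {f g : ℝ → ℝ} (hfg : EqOn f g (Icc 0 1)) (Ω : ℝ) (n : ℕ) {r : ℝ}
    (hr : r ∈ Icc (0 : ℝ) 1) : Gfun f Ω n r = Gfun g Ω n r := by
  have h0 : (0 : ℝ) ∈ Icc (0 : ℝ) 1 := ⟨le_rfl, zero_le_one⟩
  unfold Gfun
  rw [intervalIntegral_mul_congr hfg h0 ⟨zero_le_one, le_rfl⟩,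
    intervalIntegral_mul_congr hfg h0 hr, intervalIntegral_mul_congr hfg h0 hr]

/-- The equivalence needs no lower bound on `Ω - κ₂`: if `F(1) = 0`, then `F'(1) ≠ 0` takes its
place. -/
theorem exists_kernel_iff_zeta_eq_zero {f₀ : ℝ → ℝ} (hf₀ : IsProfile f₀) {n : ℕ} (hn : 1 ≤ n)
    {Ω : ℝ} (hΩ : Ω ∉ Icc (kappa₁ f₀) (kappa₂ f₀)) (hne : Ω ≠ omegaHat f₀ n) :
    (∃ h : ℝ → ℝ, ContinuousOn h (Icc 0 1) ∧ (∃ r ∈ Icc (0 : ℝ) 1, h r ≠ 0) ∧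
      SolvesKernelEq f₀ Ω n h) ↔ zeta f₀ n Ω = 0 := by
  have hn0 : (n : ℝ) ≠ 0 := by positivity
  have hn1 : (n : ℝ) + 1 ≠ 0 := by positivity
  have h0 : (0 : ℝ) ∈ Icc (0 : ℝ) 1 := ⟨le_rfl, zero_le_one⟩
  have h1 : (1 : ℝ) ∈ Icc (0 : ℝ) 1 := ⟨zero_le_one, le_rfl⟩
  obtain ⟨f, hf, hff⟩ := exists_continuous_eqOn_Icc hf₀.continuousOn
  obtain ⟨μ, hμ, hmu⟩ := hf₀.exists_continuous_eq_mu hΩ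
  obtain ⟨F, ψ, hF, hψ, hψe, hFi, hFp⟩ :=
    exists_isRadialPair (2 * n + 1) (φ := fun _ => 0) continuous_const hμ 1
  have hFg : EqOn (generator f₀ n Ω) F (Icc 0 1) :=
    (isRegularSolution_generator hf₀ n hΩ).eqOn hf₀ hΩ
      (isRegularSolution_of_eq_radialInt hmu hψ hψe hFi)
  have hG : Gfun f Ω n 1 ≠ 0 := by
    rw [Gfun_congr hff Ω n h1, Gfun_one f₀ Ω hn]
    exact mul_ne_zero hn0 (sub_ne_zero.2 hne)
  have hζ : zeta f₀ n Ω = F 1 * (Ω - (n : ℝ) / (n + 1) * ∫ s in (0 : ℝ)..1, s * f s)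
      + ∫ s in (0 : ℝ)..1, F s * s ^ (2 * n + 1) * (f s - 2 * Ω) := by
    rw [zeta, hFg h1, intervalIntegral_mul_congr hff h0 h1]
    congr 1
    refine intervalIntegral.integral_congr fun s hs => ?_
    rw [uIcc_of_le zero_le_one] at hs
    simp only [hFg hs, hff hs]
  rw [hζ]
  constructor
  · rintro ⟨h, hh, ⟨r, hr, hhr⟩, hker⟩
    by_contra hne0
    obtain ⟨k, hk, hkh⟩ := exists_continuous_eqOn_Icc hh
    have hzero := eq_zero_of_kernelEq hn hf hk hμ hF hψ hFp hG (fun t ht => by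
      have ht' := Ioc_subset_Icc_self ht
      rw [hkh ht', ← hmu t ht, Hop_congr hkh n ht', Hop_congr hkh n h1, Gfun_congr hff Ω n h1,
        Gfun_congr hff Ω n ht']
      exact hker t ht) hne0
    have hclosed : EqOn k (fun _ => 0) (closure (Ioc 0 1)) :=
      EqOn.closure (fun t ht => hzero t ht) hk continuous_const
    rw [closure_Ioc zero_ne_one] at hclosed
    exact hhr (by rw [← hkh hr, hclosed hr])
  · intro hz
    have hint : ∫ s in (0 : ℝ)..1, s ^ (2 * n + 1) * (2 * n * (n + 1) * (f s - 2 * Ω)) * F s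
        = 2 * n * (n + 1) * ∫ s in (0 : ℝ)..1, F s * s ^ (2 * n + 1) * (f s - 2 * Ω) := by
      rw [← intervalIntegral.integral_const_mul]
      congr 1
      ext s
      ring
    -- The data are those of the amplitude normalised by `c = 1`.
    obtain ⟨y, P, hy, hP, hP0, hy1, hP1, hpair⟩ := exists_isRadialPair_of_dispersion
      (φ := fun r => 2 * n * (n + 1) * (f r - 2 * Ω))
      (p := -(2 * n * (n + 1)) * (Ω - (n : ℝ) / (n + 1) * ∫ s in (0 : ℝ)..1, s * f s))
      (by fun_prop) hμ hF hψ (by simp [hFi, radialInt]) hFp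
      (by rw [hint]; linear_combination (2 * n * (n + 1) : ℝ) * hz)
    have hHop := fun {r : ℝ} => Hop_of_isRadialPair (r := r) hn hf hμ hy hP hP0 hy1 hP1 hpair
    have hHop1 := hHop (⟨one_pos, le_rfl⟩ : (1 : ℝ) ∈ Ioc (0 : ℝ) 1)
    simp only [one_pow, one_mul, hy1, add_zero] at hHop1
    refine ⟨fun r => μ r * r ^ n * y r / (2 * n), by fun_prop, ?_, fun r hr => ?_⟩
    -- The solution is nontrivial because `H_n[h](1) = G_n(1) ≠ 0`.
    · by_contra! hall
      refine hG (hHop1.symm.trans ?_)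
      rw [Hop_congr (k := fun _ => 0) hall n h1]
      simp [Hop]
    · have hr0 : r ≠ 0 := hr.1.ne'
      rw [hHop hr, hHop1, ← Gfun_congr hff Ω n h1, ← Gfun_congr hff Ω n (Ioc_subset_Icc_self hr),
        hmu r hr]
      field_simp
      ring

theorem lemma4p6 (f₀ : ℝ → ℝ) (hf₀ : IsProfile f₀) :
    (∀ n : ℕ, 1 ≤ n → ∀ Ω : ℝ, Ω ∉ Set.Icc (kappa₁ f₀) (kappa₂ f₀) →
      IsRegularSolution f₀ n Ω (generator f₀ n Ω) ∧
      ∀ F : ℝ → ℝ, IsRegularSolution f₀ n Ω F →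
        Set.EqOn F (generator f₀ n Ω) (Set.Icc 0 1)) ∧
    ∃ C₀ : ℝ, 0 < C₀ ∧
      ∀ n : ℕ, 1 ≤ n → ∀ Ω : ℝ, Ω ∉ Set.Icc (kappa₁ f₀) (kappa₂ f₀) →
        Ω ≠ omegaHat f₀ n →
        (kappa₂ f₀ < Ω → ∃ θ : ℝ, 0 < θ ∧ θ ≤ 1 ∧
          C₀ / (n * θ * (Ω - kappa₂ f₀) ^ θ) < 1) →
        ((∃ h : ℝ → ℝ, ContinuousOn h (Set.Icc 0 1) ∧ (∃ r ∈ Set.Icc (0 : ℝ) 1, h r ≠ 0) ∧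
            SolvesKernelEq f₀ Ω n h) ↔
          zeta f₀ n Ω = 0) := by
  refine ⟨fun n _ Ω hΩ => ?_, 1, one_pos, fun n hn Ω hΩ hne _ =>
    exists_kernel_iff_zeta_eq_zero hf₀ hn hΩ hne⟩
  have hgen := isRegularSolution_generator hf₀ n hΩ
  exact ⟨hgen, fun F hF => hF.eqOn hf₀ hΩ hgen⟩
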